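/- Let $\mathbb S^{d-1}\subset\mathbb R^d$ be the unit sphere with its geodesic distance $d_g(x,y)=\arccos\langle x,y\rangle$. Let $\mathrm{conv}_g A$ be the geodesic convex hull of $A\subset\mathbb S^{d-1}$, i.e. the smallest set containing $A$ and every minimizing geodesic between any two of its points; let $\mathrm{diam}$ be the diameter for $d_g$, and let $\mathsf W_p$, $p\in[1,\infty]$, be the Wasserstein distances of $(\mathbb S^{d-1},d_g)$. Let $B\in\mathbb R^{d\times d}$ be a constant matrix and let $\mu_0$ be a Borel probability measure on $\mathbb S^{d-1}$ whose support is contained in an open hemisphere $\{x:\langle w,x\rangle>0\}$, $w\in\mathbb S^{d-1}$. Let $\mu\in C^0([0,\infty);\mathscr P(\mathbb S^{d-1}))$ (with the weak topology) be the weak solution of $$\partial_t\mu(t)+\mathrm{div}\big(\mu(t)\,\mathsf v[\mu(t)]\big)=0,\qquad \mu(0)=\mu_0,$$ for the Transformer vector field $$\mathsf v[\mu](t,x)=P_x^{\perp}\big(V(t)\,\mathscr A_{B}[\mu](x)+W(t)(U(t)x+b(t))_+\big),\qquad \mathscr A_B[\mu](x)=\frac{\int e^{\langle Bx,x'\rangle}x'\,\mu(dx')}{\int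 e^{\langle Bx,\zeta\rangle}\,\mu(d\zeta)},\qquad P_x^\perp=I_d-xx^\top,$$ with $V\equiv I_d$, $B(\cdot)\equiv B$ and $W\equiv0$ (so that $U,b$ play no role). Then $$\mathrm{diam}\big(\mathrm{conv}_g\,\mathrm{supp}\,\mu(t)\big)\to0\qquad\text{as }t\to+\infty .$$ Moreover, there is a point $z\in\mathrm{conv}_g\,\mathrm{supp}\,\mu_0$ such that for every $\varepsilon>0$ there is $T>0$ with $\mathsf W_\infty(\mu(T),\delta_z)\le\varepsilon$, the set $\{t\ge0:\mathsf W_2(\mu(t),\delta_z)\le\varepsilon\}$ is non-empty for every $\varepsilon>0$, and $$\inf\{t\ge0:\mathsf W_2(\mu(t),\delta_z)\le\varepsilon\}=O\Big(\log\frac1\varepsilon\Big)\qquad\text{as }\varepsilon\to0^+,$$ where the constant in $O(\cdot)$ does not depend on $\varepsilon$ (it may depend on $d$, $B$ and $\mu_0$). -/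

import Mathlib

open MeasureTheory Set Filter Topology
open scoped RealInnerProductSpace ENNReal

namespace Transformer

noncomputable section

/-- The Euclidean space `ℝ^d`. -/
abbrev E (d : ℕ) : Type := EuclideanSpace ℝ (Fin d)

/-- The unit sphere of `ℝ^d`. -/
abbrev Sph (d : ℕ) : Type := Metric.sphere (0 : E d) 1

/-! ### Geodesic geometry of the sphere -/

/-- The geodesic distance of the unit sphere: the angle `arccos ⟪x, y⟫`. -/
def geodDist {d : ℕ} (x y : Sph d) : ℝ :=
  InnerProductGeometry.angle (x : E d) (y : E d)

/-- The union of all minimizing geodesics between `x` and `y`: the points at which the triangle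
inequality for the geodesic distance is an equality. If `y ≠ -x`, this is the unique minimizing
geodesic between `x` and `y`. -/
def geodSegment {d : ℕ} (x y : Sph d) : Set (Sph d) :=
  {z | geodDist x z + geodDist z y = geodDist x y}

/-- `C` is geodesically convex: it contains every minimizing geodesic between two of its points. -/
def GeodConvex {d : ℕ} (C : Set (Sph d)) : Prop :=
  ∀ x ∈ C, ∀ y ∈ C, geodSegment x y ⊆ C

/-- The geodesic convex hull: the smallest geodesically convex set that contains `A`. -/
def geodHull {d : ℕ} (A : Set (Sph d)) : Set (Sph d) :=
  ⋂₀ {C | A ⊆ C ∧ GeodConvex C}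

/-- The diameter for the geodesic distance (the distances are bounded by `π`). -/
def geodDiam {d : ℕ} (A : Set (Sph d)) : ℝ :=
  sSup {r | ∃ x ∈ A, ∃ y ∈ A, r = geodDist x y}

/-- `A` is contained in an open hemisphere. -/
def InOpenHemisphere {d : ℕ} (A : Set (Sph d)) : Prop :=
  ∃ w : Sph d, ∀ x ∈ A, 0 < ⟪(w : E d), (x : E d)⟫

/-! ### Wasserstein distances on the sphere -/

/-- The couplings of `μ` and `ν`. -/
def couplings {d : ℕ} (μ ν : Measure (Sph d)) : Set (Measure (Sph d × Sph d)) :=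
  {π | π.map Prod.fst = μ ∧ π.map Prod.snd = ν}

/-- The Wasserstein distance of order `p` for the geodesic distance, that is, the infimum over all
couplings `π` of the `L^p(π)` norm of the distance function (its essential supremum if `p = ∞`). -/
def wasserstein {d : ℕ} (p : ℝ≥0∞) (μ ν : Measure (Sph d)) : ℝ≥0∞ :=
  ⨅ π ∈ couplings μ ν, eLpNorm (fun q : Sph d × Sph d => geodDist q.1 q.2) p π

/-! ### The Transformer dynamics -/

/-- The values of the parameters at one time: four matrices and a vector. -/
structure Params (d : ℕ) where
  V : Matrix (Fin d) (Fin d) ℝ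
  B : Matrix (Fin d) (Fin d) ℝ
  W : Matrix (Fin d) (Fin d) ℝ
  U : Matrix (Fin d) (Fin d) ℝ
  b : E d

/-- The action of a matrix on a vector. -/
def mulE {d : ℕ} (M : Matrix (Fin d) (Fin d) ℝ) (x : E d) : E d :=
  WithLp.toLp 2 (M.mulVec (WithLp.ofLp x))

/-- The componentwise positive part. -/
def relu {d : ℕ} (x : E d) : E d :=
  WithLp.toLp 2 (fun i => max (x i) 0)

/-- The projection `y - ⟪x, y⟫ x`; for `x` on the unit sphere it is the orthogonal projection onto
the tangent space at `x`. -/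
def projPerp {d : ℕ} (x y : E d) : E d := y - ⟪x, y⟫ • x

/-- The self-attention map: the barycenter of `μ` with the weights `exp ⟪B x, x'⟫`. -/
def attention {d : ℕ} (B : Matrix (Fin d) (Fin d) ℝ) (μ : Measure (Sph d)) (x : E d) : E d :=
  (∫ ζ : Sph d, Real.exp ⟪mulE B x, (ζ : E d)⟫ ∂μ)⁻¹ •
    ∫ y : Sph d, Real.exp ⟪mulE B x, (y : E d)⟫ • (y : E d) ∂μ

/-- The vector field of the dynamics: attention plus perceptron, projected to the tangent space. -/
def velocity {d : ℕ} (θ : Params d) (μ : Measure (Sph d)) (x : E d) : E d :=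
  projPerp x (mulE θ.V (attention θ.B μ x) + mulE θ.W (relu (mulE θ.U x + θ.b)))

/-- `μ` is a weak solution on `[0, ∞)` of the continuity equation
`∂ₜ μ + div (μ v[μ]) = 0` on the sphere with data `μ₀`: it is continuous in time for the weak
topology, it starts at `μ₀`, and it satisfies the equation, integrated in time, against every
`C¹` test function of the sphere. A test function of the sphere is written as the restriction of
a `C¹` function `φ` on `ℝ^d` (every one is of this form); as `v` is tangent to the sphere, the
derivative `Dφ(x) v(x)` is the inner product of `v(x)` with the spherical gradient. -/
structure IsWeakSolution {d : ℕ} (θ : ℝ → Params d) (μ₀ : ProbabilityMeasure (Sph d))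
    (μ : ℝ → ProbabilityMeasure (Sph d)) : Prop where
  continuousOn : ContinuousOn μ (Ici 0)
  initial : μ 0 = μ₀
  weak_eq : ∀ φ : E d → ℝ, ContDiff ℝ 1 φ → ∀ t : ℝ, 0 ≤ t →
    ∫ x : Sph d, φ x ∂(μ t : Measure (Sph d)) =
      ∫ x : Sph d, φ x ∂(μ₀ : Measure (Sph d)) +
        ∫ s in (0 : ℝ)..t,
          ∫ x : Sph d, fderiv ℝ φ x (velocity (θ s) (μ s) x) ∂(μ s : Measure (Sph d))

/-- The times at which the curve `μ` is `ε`-close to `ν` in `W_2`. -/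
def hittingTimes {d : ℕ} (μ : ℝ → ProbabilityMeasure (Sph d)) (ν : Measure (Sph d)) (ε : ℝ) :
    Set ℝ :=
  {t | 0 ≤ t ∧ wasserstein 2 (μ t) ν ≤ ENNReal.ofReal ε}

end

end Transformer

/-! The proof never uses characteristics. The squared positive part of an affine function is a `C¹`
test function whose integral vanishes exactly when the support lies in the corresponding cap. If the
affine function grows at most linearly outside the cap, Grönwall keeps that integral at zero, even
when the cap moves in time (`AttentionFlow.le_zero_of_barrier`).

The normalized attention weights lie between `κ` and `κ⁻¹`, uniformly in the measure
(`exists_attention_le`), so up to such factors attention is the plain mean. Hence caps no larger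
than a hemisphere are invariant. In the gnomonic chart `x / ⟪w, x⟫`, a barrier coordinate `β` for
direction `n` may relax towards the chart coordinate `N` of the barycenter, `β' = -c (β - N)`. The
barriers for `n` and `-n` relax towards opposite values, so their sum, the width of the support,
decays like `exp (-c t)` (`AttentionFlow.exists_contraction`).

The bipolar cones of the supports are nested. A common unit vector `z` lies in the initial geodesic
hull by the bipolar theorem, and in every slab that contains the support, so the support is
exponentially close to `z`. All the claims follow from this rate. -/

/-- In finite dimension, the convex hull of a compact set is compact. -/
theorem IsCompact.convexHull_of_finiteDimensional {F : Type*} [NormedAddCommGroup F]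
    [NormedSpace ℝ F] [FiniteDimensional ℝ F] {s : Set F} (hs : IsCompact s) :
    IsCompact (convexHull ℝ s) := by
  -- Carathéodory: at most `finrank + 1` points are needed, so the hull is a finite union of
  -- continuous images of compact sets.
  have key : convexHull ℝ s = ⋃ k ∈ Finset.range (Module.finrank ℝ F + 2),
      (fun p : (Fin k → ℝ) × (Fin k → F) => ∑ i, p.1 i • p.2 i) ''
        (stdSimplex ℝ (Fin k) ×ˢ Set.univ.pi fun _ => s) := by
    apply Set.Subset.antisymm
    · intro x hx
      obtain ⟨ι, _, z, w, hz, hai, hw, hw1, hx⟩ := eq_pos_convex_span_of_mem_convexHull hx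
      have hcard := hai.card_le_finrank_succ
      have hfin := Submodule.finrank_le (vectorSpan ℝ (Set.range z))
      let e := (Fintype.equivFin ι).symm
      simp only [Set.mem_iUnion]
      refine ⟨Fintype.card ι, Finset.mem_range.2 (by omega), (w ∘ e, z ∘ e),
        ⟨⟨fun i => (hw _).le, ?_⟩, fun i _ => hz ⟨_, rfl⟩⟩, ?_⟩
      · simpa using (e.sum_comp w).trans hw1
      · simpa using (e.sum_comp fun i => w i • z i).trans hx
    · simp only [Set.iUnion_subset_iff]
      rintro k - _ ⟨⟨w, z⟩, ⟨hw, hz⟩, rfl⟩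
      exact (convex_convexHull ℝ s).sum_mem (fun i _ => hw.1 i) hw.2
        fun i _ => subset_convexHull ℝ s (hz i trivial)
  rw [key]
  refine Finset.isCompact_biUnion _ fun k _ => IsCompact.image ?_ (by fun_prop)
  exact (isCompact_stdSimplex ℝ _).prod (isCompact_univ_pi fun _ => hs)

/-! ### Geodesic hulls and convex cones -/

namespace Transformer

variable {d : ℕ}

theorem mem_geodSegment_of_cone {x y z : Sph d} {a b : ℝ} (ha : 0 ≤ a) (hb : 0 ≤ b)
    (h : (z : E d) = a • (x : E d) + b • (y : E d)) : z ∈ geodSegment x y := by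
  have hz : (z : E d) ≠ 0 := ne_zero_of_mem_unit_sphere z
  refine ((InnerProductGeometry.angle_eq_angle_add_angle_iff hz).2 (Or.inr ?_)).symm
  rw [Submodule.mem_span_pair]
  exact ⟨⟨a, ha⟩, ⟨b, hb⟩, h.symm⟩

/-- Equality in the triangle inequality for angles forces a cone combination unless `x` and `y` are
antipodal, which a common open hemisphere excludes. -/
theorem exists_cone_of_mem_geodSegment {w : E d} {x y z : Sph d} (hx : 0 < ⟪w, (x : E d)⟫)
    (hy : 0 < ⟪w, (y : E d)⟫) (h : z ∈ geodSegment x y) :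
    ∃ a b : ℝ, 0 ≤ a ∧ 0 ≤ b ∧ (z : E d) = a • (x : E d) + b • (y : E d) := by
  have hz : (z : E d) ≠ 0 := ne_zero_of_mem_unit_sphere z
  rcases (InnerProductGeometry.angle_eq_angle_add_angle_iff hz).1 (Eq.symm h) with h | h
  · obtain ⟨-, r, hr, hxy⟩ := InnerProductGeometry.angle_eq_pi_iff.1 h
    rw [hxy, real_inner_smul_right] at hy
    nlinarith
  · obtain ⟨a, b, hab⟩ := Submodule.mem_span_pair.1 h
    exact ⟨a, b, a.2, b.2, hab.symm⟩

theorem geodConvex_hemisphere (w : E d) : GeodConvex {x : Sph d | 0 < ⟪w, (x : E d)⟫} := by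
  intro x hx y hy z hz
  obtain ⟨a, b, ha, hb, h⟩ := exists_cone_of_mem_geodSegment hx hy hz
  have hx' : 0 < ⟪w, (x : E d)⟫ := hx
  have hy' : 0 < ⟪w, (y : E d)⟫ := hy
  have hz0 : (z : E d) ≠ 0 := ne_zero_of_mem_unit_sphere z
  show 0 < ⟪w, (z : E d)⟫
  rw [h, inner_add_right, real_inner_smul_right, real_inner_smul_right]
  rcases ha.eq_or_lt with rfl | ha
  · rcases hb.eq_or_lt with rfl | hb
    · simp [h] at hz0
    · positivity
  · positivity

/-- Since `z = a x + b y` has norm one, `a + b ≥ 1`; the positivity of `s` then gives `(a + b) s ≥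
s`. -/
theorem geodConvex_cap (w : E d) {s : ℝ} (hs : 0 < s) :
    GeodConvex {x : Sph d | s ≤ ⟪w, (x : E d)⟫} := by
  intro x hx y hy z hz
  have hx' : s ≤ ⟪w, (x : E d)⟫ := hx
  have hy' : s ≤ ⟪w, (y : E d)⟫ := hy
  obtain ⟨a, b, ha, hb, h⟩ :=
    exists_cone_of_mem_geodSegment (hs.trans_le hx') (hs.trans_le hy') hz
  have hab : 1 ≤ a + b := by
    have := norm_add_le (a • (x : E d)) (b • (y : E d))
    rwa [← h, norm_smul, norm_smul, norm_eq_of_mem_sphere, norm_eq_of_mem_sphere,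
      norm_eq_of_mem_sphere, Real.norm_of_nonneg ha, Real.norm_of_nonneg hb, mul_one,
      mul_one] at this
  show s ≤ ⟪w, (z : E d)⟫
  rw [h, inner_add_right, real_inner_smul_right, real_inner_smul_right]
  nlinarith

theorem subset_geodHull (A : Set (Sph d)) : A ⊆ geodHull A :=
  fun _ hx _ hC => hC.1 hx

theorem geodConvex_geodHull (A : Set (Sph d)) : GeodConvex (geodHull A) :=
  fun x hx y hy _ hz C hC => hC.2 x (hx C hC) y (hy C hC) hz

theorem geodHull_subset {A C : Set (Sph d)} (hA : A ⊆ C) (hC : GeodConvex C) : geodHull A ⊆ C :=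
  fun _ hx => hx C ⟨hA, hC⟩

/-- A point of the convex hull of a subset of an open hemisphere lies on a ray through the
geodesic hull. -/
theorem exists_pos_smul_mem_geodHull {A : Set (Sph d)} {w : E d}
    (hA : ∀ x ∈ A, 0 < ⟪w, (x : E d)⟫) {y : E d}
    (hy : y ∈ convexHull ℝ ((fun x : Sph d => (x : E d)) '' A)) :
    ∃ c ∈ geodHull A, ∃ r : ℝ, 0 < r ∧ y = r • (c : E d) := by
  have hpos : ∀ c ∈ geodHull A, 0 < ⟪w, (c : E d)⟫ :=
    fun c hc => geodHull_subset hA (geodConvex_hemisphere w) hc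
  -- The cone over the geodesic hull is convex: a convex combination is nonzero because its product
  -- with `w` is positive, and its normalization lies on a geodesic segment.
  have hD : Convex ℝ {y : E d | ∃ c ∈ geodHull A, ∃ r : ℝ, 0 < r ∧ y = r • (c : E d)} := by
    rintro _ ⟨c₁, hc₁, r₁, hr₁, rfl⟩ _ ⟨c₂, hc₂, r₂, hr₂, rfl⟩ a b ha hb hab
    set y : E d := a • r₁ • (c₁ : E d) + b • r₂ • (c₂ : E d) with hy
    have hwy : 0 < ⟪w, y⟫ := by
      have h₁ := hpos c₁ hc₁
      have h₂ := hpos c₂ hc₂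
      simp only [hy, inner_add_right, real_inner_smul_right]
      rcases ha.eq_or_lt with rfl | ha
      · have : b = 1 := by linarith
        subst this
        positivity
      · positivity
    have hy0 : 0 < ‖y‖ := norm_pos_iff.2 fun h => by simp [h] at hwy
    let c : Sph d := ⟨‖y‖⁻¹ • y, by
      rw [mem_sphere_zero_iff_norm, norm_smul, norm_inv, norm_norm, inv_mul_cancel₀ hy0.ne']⟩
    refine ⟨c, geodConvex_geodHull A c₁ hc₁ c₂ hc₂
      (mem_geodSegment_of_cone (a := ‖y‖⁻¹ * (a * r₁)) (b := ‖y‖⁻¹ * (b * r₂))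
        (by positivity) (by positivity) ?_), ‖y‖, hy0, ?_⟩
    · show ‖y‖⁻¹ • y = _
      rw [hy]
      simp only [smul_add, smul_smul]
    · show y = ‖y‖ • ‖y‖⁻¹ • y
      rw [smul_smul, mul_inv_cancel₀ hy0.ne', one_smul]
  refine convexHull_min ?_ hD hy
  rintro _ ⟨x, hx, rfl⟩
  exact ⟨x, subset_geodHull A hx, 1, one_pos, (one_smul _ _).symm⟩

/-- The bipolar theorem for geodesic hulls of closed subsets of an open hemisphere. -/
theorem mem_geodHull_of_polar {A : Set (Sph d)} (hAc : IsClosed A) {w : E d}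
    (hA : ∀ x ∈ A, 0 < ⟪w, (x : E d)⟫) {z : Sph d} (hwz : 0 < ⟪w, (z : E d)⟫)
    (hz : ∀ n : E d, (∀ x ∈ A, ⟪n, (x : E d)⟫ ≤ 0) → ⟪n, (z : E d)⟫ ≤ 0) :
    z ∈ geodHull A := by
  by_cases hmeet : ∃ s : ℝ, 0 ≤ s ∧
      s • (z : E d) ∈ convexHull ℝ ((fun x : Sph d => (x : E d)) '' A)
  · obtain ⟨s, hs, hsz⟩ := hmeet
    obtain ⟨c, hc, r, hr, h⟩ := exists_pos_smul_mem_geodHull hA hsz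
    have hsr : s = r := by
      have := congrArg norm h
      rwa [norm_smul, norm_smul, norm_eq_of_mem_sphere, norm_eq_of_mem_sphere,
        Real.norm_of_nonneg hs, Real.norm_of_nonneg hr.le, mul_one, mul_one] at this
    subst hsr
    have : z = c := Subtype.ext (smul_right_injective _ hr.ne' h)
    rwa [this]
  · exfalso
    have hcomp : IsCompact (convexHull ℝ ((fun x : Sph d => (x : E d)) '' A)) :=
      (hAc.isCompact.image continuous_subtype_val).convexHull_of_finiteDimensional
    have hray : Convex ℝ ((fun s : ℝ => s • (z : E d)) '' Ici 0) := by
      have := (convex_Ici (0 : ℝ)).linear_image (LinearMap.toSpanSingleton ℝ (E d) z)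
      simpa [LinearMap.toSpanSingleton_apply] using this
    have hrayc : IsClosed ((fun s : ℝ => s • (z : E d)) '' Ici 0) :=
      (isClosedMap_smul_left (𝕜 := ℝ) (z : E d)) _ isClosed_Ici
    have hdisj : Disjoint (convexHull ℝ ((fun x : Sph d => (x : E d)) '' A))
        ((fun s : ℝ => s • (z : E d)) '' Ici 0) := by
      rw [Set.disjoint_left]
      rintro _ hy ⟨s, hs, rfl⟩
      exact hmeet ⟨s, hs, hy⟩
    -- The separating functional is below `u < 0` on `A`, but nonnegative at `z` because it is
    -- bounded below on the whole ray.
    obtain ⟨f, u, v, hu, huv, hv⟩ :=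
      geometric_hahn_banach_compact_closed (convex_convexHull ℝ _) hcomp hray hrayc hdisj
    have hv0 : v < 0 := by simpa using hv _ ⟨0, Set.self_mem_Ici, rfl⟩
    have hvs : ∀ s : ℝ, 0 ≤ s → v < s * f z := fun s hs => by
      simpa using hv _ ⟨s, hs, rfl⟩
    have hfz : 0 ≤ f z := by
      by_contra! hneg
      have := hvs (v / f z) (div_nonneg_of_nonpos hv0.le hneg.le)
      rw [div_mul_cancel₀ _ hneg.ne] at this
      exact lt_irrefl _ this
    obtain ⟨n, hn⟩ : ∃ n : E d, ∀ x, f x = ⟪n, x⟫ :=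
      ⟨(InnerProductSpace.toDual ℝ (E d)).symm f, fun x => by simp⟩
    -- Tilting by `δ w` makes the value at `z` strictly positive; `δ` is small enough that the
    -- values on `A` stay negative.
    set δ : ℝ := -u / (‖w‖ + 1) with hδ
    have hδ0 : 0 < δ := div_pos (by linarith) (by positivity)
    have := hz (n + δ • w) fun x hx => by
      have h1 : f x < u := hu _ (subset_convexHull ℝ _ ⟨x, hx, rfl⟩)
      have h2 : ⟪w, (x : E d)⟫ ≤ ‖w‖ := by
        simpa using real_inner_le_norm w (x : E d)
      have h3 : δ * (‖w‖ + 1) = -u := by rw [hδ]; field_simp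
      rw [inner_add_left, real_inner_smul_left, ← hn]
      nlinarith
    rw [inner_add_left, real_inner_smul_left, ← hn] at this
    nlinarith [mul_pos hδ0 hwz]

/-! ### Geodesic distance, diameter and distance to a Dirac mass -/

theorem geodDist_comm (x y : Sph d) : geodDist x y = geodDist y x :=
  InnerProductGeometry.angle_comm _ _

theorem geodDist_nonneg (x y : Sph d) : 0 ≤ geodDist x y :=
  InnerProductGeometry.angle_nonneg _ _

theorem geodDist_triangle (x y z : Sph d) : geodDist x z ≤ geodDist x y + geodDist y z :=
  InnerProductGeometry.angle_le_angle_add_angle _ _ _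

theorem geodDiam_nonneg (A : Set (Sph d)) : 0 ≤ geodDiam A :=
  Real.sSup_nonneg fun _ ⟨_, _, _, _, h⟩ => h ▸ geodDist_nonneg _ _

theorem continuous_geodDist : Continuous fun q : Sph d × Sph d => geodDist q.1 q.2 := by
  unfold geodDist InnerProductGeometry.angle
  simp only [norm_eq_of_mem_sphere, mul_one, div_one]
  fun_prop

theorem inner_eq_cos_geodDist (x y : Sph d) : ⟪(x : E d), (y : E d)⟫ = Real.cos (geodDist x y) := by
  rw [geodDist, InnerProductGeometry.cos_angle]
  simp

/-- The geodesic distance is at most `π / 2` times the chordal distance. -/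
theorem geodDist_le_chord (x y : Sph d) : geodDist x y ≤ Real.pi / 2 * ‖(x : E d) - y‖ := by
  have h1 : ‖(x : E d) - y‖ ^ 2 = (2 * Real.sin (geodDist x y / 2)) ^ 2 := by
    rw [norm_sub_sq_real, inner_eq_cos_geodDist, norm_eq_of_mem_sphere, norm_eq_of_mem_sphere,
      mul_pow, Real.sin_sq_eq_half_sub, mul_div_cancel₀ _ two_ne_zero]
    ring
  have h0 := geodDist_nonneg x y
  have hpi : geodDist x y ≤ Real.pi := InnerProductGeometry.angle_le_pi _ _
  have hs := Real.mul_le_sin (x := geodDist x y / 2) (by linarith) (by linarith)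
  have hsin : 0 ≤ Real.sin (geodDist x y / 2) :=
    Real.sin_nonneg_of_nonneg_of_le_pi (by linarith) (by linarith)
  have h2 := (sq_eq_sq₀ (norm_nonneg _) (by positivity)).1 h1
  rw [h2]
  have hpp := Real.pi_pos
  calc geodDist x y = Real.pi / 2 * (2 * (2 / Real.pi * (geodDist x y / 2))) := by
        field_simp
    _ ≤ _ := by gcongr

/-- If `A` lies in the geodesic ball of radius `r < π / 2` around `z`, then so does its geodesic
hull. -/
theorem geodDiam_geodHull_le {A : Set (Sph d)} {z : Sph d} {r : ℝ} (hr0 : 0 ≤ r)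
    (hr : r < Real.pi / 2) (hA : ∀ x ∈ A, geodDist x z ≤ r) : geodDiam (geodHull A) ≤ 2 * r := by
  have hpi := Real.pi_pos
  have hcos : 0 < Real.cos r := Real.cos_pos_of_mem_Ioo ⟨by linarith, hr⟩
  -- As `r < π / 2`, the ball is a cap with threshold `cos r > 0`, hence geodesically convex.
  have hcap : ∀ x ∈ geodHull A, geodDist x z ≤ r := by
    intro x hx
    have h : Real.cos r ≤ ⟪(z : E d), (x : E d)⟫ := by
      refine geodHull_subset (fun y hy => ?_) (geodConvex_cap (z : E d) hcos) hx
      show Real.cos r ≤ ⟪(z : E d), (y : E d)⟫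
      rw [inner_eq_cos_geodDist, geodDist_comm]
      exact Real.cos_le_cos_of_nonneg_of_le_pi (geodDist_nonneg _ _) (by linarith) (hA y hy)
    rw [inner_eq_cos_geodDist, geodDist_comm] at h
    exact (Real.strictAntiOn_cos.le_iff_ge ⟨hr0, by linarith⟩
      ⟨geodDist_nonneg _ _, InnerProductGeometry.angle_le_pi _ _⟩).1 h
  refine Real.sSup_le ?_ (by linarith)
  rintro _ ⟨x, hx, y, hy, rfl⟩
  have h1 := geodDist_triangle x z y
  have h2 := hcap x hx
  have h3 := hcap y hy
  rw [geodDist_comm] at h3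
  linarith

/-- If `μ` lives in the geodesic ball of radius `r` around `z`, then all its Wasserstein distances
to the Dirac mass at `z` are at most `r`. -/
theorem wasserstein_dirac_le (p : ℝ≥0∞) (μ : Measure (Sph d)) [IsProbabilityMeasure μ] (z : Sph d)
    {r : ℝ} (h : ∀ x ∈ μ.support, geodDist x z ≤ r) :
    wasserstein p μ (Measure.dirac z) ≤ ENNReal.ofReal r := by
  have hπ : μ.prod (Measure.dirac z) ∈ couplings μ (Measure.dirac z) := by
    constructor <;> simp
  refine (iInf₂_le _ hπ).trans ?_
  have hae : ∀ᵐ q ∂(μ.prod (Measure.dirac z)), ‖geodDist q.1 q.2‖ ≤ r := by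
    rw [Measure.prod_dirac, ae_map_iff (by fun_prop)
      (measurableSet_le continuous_geodDist.measurable.norm measurable_const)]
    filter_upwards [Measure.support_mem_ae (μ := μ)] with x hx
    rw [Real.norm_of_nonneg (geodDist_nonneg _ _)]
    exact h x hx
  simpa using eLpNorm_le_of_ae_bound (p := p) hae

end Transformer

/-! ### Weak solutions and the barrier principle -/

/-- On a compact space, the integral of a jointly continuous integrand against a weakly continuous
family of probability measures is continuous. -/
theorem MeasureTheory.ProbabilityMeasure.continuous_integral_of_compactSpace {T X : Type*}
    [TopologicalSpace T] [TopologicalSpace X] [CompactSpace X] [MeasurableSpace X]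
    [OpensMeasurableSpace X] {m : T → ProbabilityMeasure X} (hm : Continuous m) {G : T → X → ℝ}
    (hG : Continuous (Function.uncurry G)) :
    Continuous fun t => ∫ x, G t x ∂(m t : Measure X) := by
  -- Currying gives continuity in the sup norm: changing the integrand costs at most `‖g t - g t₀‖`,
  -- and changing the measure is weak convergence.
  let g : C(T, C(X, ℝ)) := ContinuousMap.curry ⟨Function.uncurry G, hG⟩
  have hint : ∀ (h : C(X, ℝ)) (t : T), Integrable h (m t : Measure X) := fun h t =>
    (BoundedContinuousFunction.mkOfCompact h).integrable _
  refine continuous_iff_continuousAt.2 fun t₀ => ?_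
  have h1 : Tendsto (fun t => ∫ x, (g t - g t₀) x ∂(m t : Measure X)) (𝓝 t₀) (𝓝 0) := by
    have hlim : Tendsto (fun t => ‖g t - g t₀‖) (𝓝 t₀) (𝓝 0) :=
      tendsto_iff_norm_sub_tendsto_zero.1 (g.continuous.tendsto t₀)
    refine squeeze_zero_norm (fun t => ?_) hlim
    simpa using norm_integral_le_of_norm_le_const (μ := (m t : Measure X))
      (Eventually.of_forall fun x => (g t - g t₀).norm_coe_le_norm x)
  have h2 : Tendsto (fun t => ∫ x, g t₀ x ∂(m t : Measure X)) (𝓝 t₀)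
      (𝓝 (∫ x, g t₀ x ∂(m t₀ : Measure X))) :=
    (ProbabilityMeasure.continuous_iff_forall_continuous_integral.1 hm
      (BoundedContinuousFunction.mkOfCompact (g t₀))).tendsto t₀
  have h3 := h1.add h2
  rw [zero_add] at h3
  refine h3.congr fun t => ?_
  rw [← integral_add (hint _ t) (hint _ t)]
  exact integral_congr_ae (Eventually.of_forall fun x => by simp [g])

/-- The square removes the kink of the positive part, making it an admissible `C¹` test function. -/
theorem hasDerivAt_max_zero_sq (s : ℝ) :
    HasDerivAt (fun s : ℝ => max s 0 ^ 2) (2 * max s 0) s := by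
  have hbound : ∀ z : ℝ, |max z 0 ^ 2 - max s 0 ^ 2 - (z - s) * (2 * max s 0)| ≤ |z - s| ^ 2 := by
    intro z
    rw [sq_abs, abs_le]
    rcases le_total z 0 with hz | hz <;> rcases le_total s 0 with hs | hs <;>
      simp only [hz, hs, max_eq_left, max_eq_right] <;> constructor <;> nlinarith
  rw [hasDerivAt_iff_isLittleO]
  refine Asymptotics.IsBigO.trans_isLittleO (g := fun z => |z - s| ^ 2)
    (Asymptotics.IsBigO.of_bound 1 (Eventually.of_forall fun z => ?_)) ?_
  · simpa using hbound z
  · have : (fun z : ℝ => ‖z - s‖ ^ 2) =o[𝓝 s] fun z => z - s :=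
      (Asymptotics.isLittleO_pow_sub_sub s one_lt_two)
    simpa using this

theorem contDiff_max_zero_sq : ContDiff ℝ 1 (fun s : ℝ => max s 0 ^ 2) := by
  rw [contDiff_one_iff_deriv]
  refine ⟨fun s => (hasDerivAt_max_zero_sq s).differentiableAt, ?_⟩
  rw [funext fun s => (hasDerivAt_max_zero_sq s).deriv]
  fun_prop

namespace Transformer

variable {d : ℕ}

theorem integrable_of_continuous {μ : Measure (Sph d)} [IsFiniteMeasure μ] {f : Sph d → ℝ}
    (hf : Continuous f) : Integrable f μ :=
  hf.integrable_of_hasCompactSupport (HasCompactSupport.of_compactSpace f)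

@[fun_prop]
theorem continuous_mulE (M : Matrix (Fin d) (Fin d) ℝ) : Continuous (mulE M) := by
  unfold mulE
  fun_prop

theorem inner_attention (B : Matrix (Fin d) (Fin d) ℝ) (μ : Measure (Sph d)) [IsFiniteMeasure μ]
    (x n : E d) :
    ⟪n, attention B μ x⟫ = (∫ y : Sph d, Real.exp ⟪mulE B x, (y : E d)⟫ ∂μ)⁻¹ *
      ∫ y : Sph d, Real.exp ⟪mulE B x, (y : E d)⟫ * ⟪n, (y : E d)⟫ ∂μ := by
  have hint : Integrable (fun y : Sph d => Real.exp ⟪mulE B x, (y : E d)⟫ • (y : E d)) μ :=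
    Continuous.integrable_of_hasCompactSupport (by fun_prop) (HasCompactSupport.of_compactSpace _)
  rw [attention, real_inner_smul_right, ← integral_inner hint]
  simp only [real_inner_smul_right]

theorem attention_weight_pos (B : Matrix (Fin d) (Fin d) ℝ) (μ : Measure (Sph d))
    [IsProbabilityMeasure μ] (x : E d) :
    0 < ∫ y : Sph d, Real.exp ⟪mulE B x, (y : E d)⟫ ∂μ :=
  integral_exp_pos (integrable_of_continuous (by fun_prop))

theorem continuous_inner_attention (B : Matrix (Fin d) (Fin d) ℝ) {T : Type*} [TopologicalSpace T]
    {m : T → ProbabilityMeasure (Sph d)} (hm : Continuous m) {x n : T → E d} (hx : Continuous x)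
    (hn : Continuous n) :
    Continuous fun t => ⟪n t, attention B (m t : Measure (Sph d)) (x t)⟫ := by
  simp only [inner_attention]
  refine Continuous.mul (Continuous.inv₀ ?_ fun t => (attention_weight_pos B _ _).ne') ?_
  · refine ProbabilityMeasure.continuous_integral_of_compactSpace hm
      (G := fun t (y : Sph d) => Real.exp ⟪mulE B (x t), (y : E d)⟫) ?_
    unfold Function.uncurry
    fun_prop
  · refine ProbabilityMeasure.continuous_integral_of_compactSpace hm
      (G := fun t (y : Sph d) => Real.exp ⟪mulE B (x t), (y : E d)⟫ * ⟪n t, (y : E d)⟫) ?_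
    unfold Function.uncurry
    fun_prop

theorem inner_projPerp (n x y : E d) : ⟪n, projPerp x y⟫ = ⟪n, y⟫ - ⟪x, y⟫ * ⟪n, x⟫ := by
  rw [projPerp, inner_sub_right, real_inner_smul_right]

/-- The velocity field for `V = 1` and `W = 0`. -/
noncomputable def attentionField (B : Matrix (Fin d) (Fin d) ℝ) (μ : Measure (Sph d)) (x : E d) :
    E d :=
  projPerp x (attention B μ x)

theorem velocity_eq_attentionField {B : Matrix (Fin d) (Fin d) ℝ} {θ : Params d} (hV : θ.V = 1)
    (hB : θ.B = B) (hW : θ.W = 0) (μ : Measure (Sph d)) (x : E d) :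
    velocity θ μ x = attentionField B μ x := by
  simp [velocity, attentionField, hV, hB, hW, mulE]

theorem continuous_inner_attentionField (B : Matrix (Fin d) (Fin d) ℝ) {T : Type*}
    [TopologicalSpace T] {m : T → ProbabilityMeasure (Sph d)} (hm : Continuous m) {x n : T → E d}
    (hx : Continuous x) (hn : Continuous n) :
    Continuous fun t => ⟪n t, attentionField B (m t : Measure (Sph d)) (x t)⟫ := by
  simp only [attentionField, inner_projPerp]
  exact (continuous_inner_attention B hm hx hn).sub
    ((continuous_inner_attention B hm hx hx).mul (hn.inner hx))

theorem fderiv_max_zero_sq (γ : ℝ) (n x u : E d) :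
    fderiv ℝ (fun x : E d => max (γ + ⟪n, x⟫) 0 ^ 2) x u = 2 * max (γ + ⟪n, x⟫) 0 * ⟪n, u⟫ := by
  have h : HasFDerivAt (fun x : E d => γ + ⟪n, x⟫) (innerSL ℝ n) x :=
    (innerSL ℝ n).hasFDerivAt.const_add γ
  have := (hasDerivAt_max_zero_sq (γ + ⟪n, x⟫)).comp_hasFDerivAt x h
  have h2 := this.fderiv
  simp only [Function.comp_def] at h2
  rw [h2]
  simp

/-- A weakly continuous curve on the whole time axis which, for nonnegative times, solves the
attention dynamics tested against squares of positive parts of affine functions. -/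
structure AttentionFlow (B : Matrix (Fin d) (Fin d) ℝ) (m : ℝ → ProbabilityMeasure (Sph d)) :
    Prop where
  continuous : Continuous m
  hasDerivWithinAt : ∀ (γ : ℝ) (n : E d) (t : ℝ), 0 ≤ t →
    HasDerivWithinAt (fun s => ∫ x : Sph d, max (γ + ⟪n, (x : E d)⟫) 0 ^ 2 ∂(m s : Measure (Sph d)))
      (∫ x : Sph d, 2 * max (γ + ⟪n, (x : E d)⟫) 0 * ⟪n, attentionField B (m t : Measure (Sph d)) x⟫
        ∂(m t : Measure (Sph d))) (Ici t) t

/-- Freezing the curve for negative times makes it continuous on `ℝ`. The integrand of the weak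
equation is then continuous in time, and the fundamental theorem of calculus gives the right
derivative, including at time zero. -/
theorem IsWeakSolution.attentionFlow {B : Matrix (Fin d) (Fin d) ℝ}
    {μ₀ : ProbabilityMeasure (Sph d)} {θ : ℝ → Params d} (hV : ∀ t, 0 ≤ t → (θ t).V = 1)
    (hB : ∀ t, 0 ≤ t → (θ t).B = B) (hW : ∀ t, 0 ≤ t → (θ t).W = 0)
    {μ : ℝ → ProbabilityMeasure (Sph d)} (hμ : IsWeakSolution θ μ₀ μ) :
    AttentionFlow B fun t => μ (max t 0) := by
  have hcont : Continuous fun t => μ (max t 0) :=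
    hμ.continuousOn.comp_continuous (by fun_prop) fun t => le_max_right t 0
  refine ⟨hcont, fun γ n t ht => ?_⟩
  set g : ℝ → ℝ := fun s => ∫ x : Sph d, 2 * max (γ + ⟪n, (x : E d)⟫) 0 *
    ⟪n, attentionField B (μ (max s 0) : Measure (Sph d)) x⟫ ∂(μ (max s 0) : Measure (Sph d)) with hg
  have hgc : Continuous g := by
    refine ProbabilityMeasure.continuous_integral_of_compactSpace hcont
      (G := fun s (x : Sph d) => 2 * max (γ + ⟪n, (x : E d)⟫) 0 *
        ⟪n, attentionField B (μ (max s 0) : Measure (Sph d)) x⟫) ?_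
    refine Continuous.mul (by fun_prop) ?_
    exact continuous_inner_attentionField B (T := ℝ × Sph d) (m := fun p => μ (max p.1 0))
      (hcont.comp continuous_fst) (x := fun p => (p.2 : E d)) (n := fun _ => n) (by fun_prop)
      (by fun_prop)
  have hderiv : HasDerivAt (fun s => ∫ x : Sph d, max (γ + ⟪n, (x : E d)⟫) 0 ^ 2
      ∂(μ₀ : Measure (Sph d)) + ∫ r in (0 : ℝ)..s, g r) (g t) t :=
    (intervalIntegral.integral_hasDerivAt_right (hgc.intervalIntegrable _ _)
      hgc.stronglyMeasurable.stronglyMeasurableAtFilter hgc.continuousAt).const_add _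
  have hφ : ContDiff ℝ 1 (fun x : E d => max (γ + ⟪n, x⟫) 0 ^ 2) :=
    contDiff_max_zero_sq.comp (contDiff_const.add (contDiff_const.inner ℝ contDiff_id))
  have heq : ∀ s ∈ Ici t, ∫ x : Sph d, max (γ + ⟪n, (x : E d)⟫) 0 ^ 2
      ∂(μ (max s 0) : Measure (Sph d)) = ∫ x : Sph d, max (γ + ⟪n, (x : E d)⟫) 0 ^ 2
      ∂(μ₀ : Measure (Sph d)) + ∫ r in (0 : ℝ)..s, g r := by
    intro s hs
    have hs0 : 0 ≤ s := ht.trans hs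
    rw [max_eq_left hs0, hμ.weak_eq _ hφ s hs0]
    congr 1
    refine intervalIntegral.integral_congr fun r hr => ?_
    rw [uIcc_of_le hs0] at hr
    simp only [hg, max_eq_left hr.1, fderiv_max_zero_sq,
      velocity_eq_attentionField (hV r hr.1) (hB r hr.1) (hW r hr.1)]
  exact hderiv.hasDerivWithinAt.congr heq (heq t Set.self_mem_Ici)

theorem integral_sq_le_integral_sq {μ : Measure (Sph d)} [IsProbabilityMeasure μ] {f : Sph d → ℝ}
    (hf : Continuous f) : (∫ x, f x ∂μ) ^ 2 ≤ ∫ x, f x ^ 2 ∂μ := by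
  set I := ∫ x, f x ∂μ with hI
  have h0 : 0 ≤ ∫ x, (f x - I) ^ 2 ∂μ := integral_nonneg fun x => sq_nonneg _
  have h1 : ∫ x, (f x - I) ^ 2 ∂μ = ∫ x, f x ^ 2 ∂μ - 2 * I * I + I ^ 2 := by
    rw [show (fun x => (f x - I) ^ 2) = fun x => f x ^ 2 - 2 * I * f x + I ^ 2 by
      funext x; ring, integral_add (integrable_of_continuous (by fun_prop)) (by simp),
      integral_sub (integrable_of_continuous (by fun_prop))
      (integrable_of_continuous (by fun_prop)), integral_const_mul]
    simp [hI]
  nlinarith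

/-- Barrier principle: the moving cap `{γ + ⟪n - β w, x⟫ ≤ 0}` remains a barrier for the support as
long as, outside of it, the affine function does not grow faster than linearly. -/
theorem AttentionFlow.le_zero_of_barrier {B : Matrix (Fin d) (Fin d) ℝ}
    {m : ℝ → ProbabilityMeasure (Sph d)} (hm : AttentionFlow B m) {β β' : ℝ → ℝ}
    (hβ : ∀ t, HasDerivAt β (β' t) t) {γ : ℝ} {n w : E d} {t₀ C : ℝ} (ht₀ : 0 ≤ t₀) (hC : 0 ≤ C)
    (hbar : ∀ t, t₀ ≤ t → ∀ x : Sph d, 0 < γ + ⟪n - β t • w, (x : E d)⟫ →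
      ⟪n - β t • w, attentionField B (m t : Measure (Sph d)) x⟫ - β' t * ⟪w, (x : E d)⟫ ≤
        C * (γ + ⟪n - β t • w, (x : E d)⟫ +
          ∫ y : Sph d, max (γ + ⟪n - β t • w, (y : E d)⟫) 0 ∂(m t : Measure (Sph d))))
    (h₀ : ∀ x ∈ (m t₀ : Measure (Sph d)).support, γ + ⟪n - β t₀ • w, (x : E d)⟫ ≤ 0)
    {t : ℝ} (ht : t₀ ≤ t) {x : Sph d} (hx : x ∈ (m t : Measure (Sph d)).support) :
    γ + ⟪n - β t • w, (x : E d)⟫ ≤ 0 := by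
  have hβc : Continuous β := continuous_iff_continuousAt.2 fun t => (hβ t).continuousAt
  set p : ℝ → Sph d → ℝ := fun t x => max (γ + ⟪n - β t • w, (x : E d)⟫) 0 with hp
  have hpc : Continuous (Function.uncurry p) := by
    simp only [hp]
    unfold Function.uncurry
    fun_prop
  have hpt : ∀ t, Continuous (p t) := fun t => by
    simp only [hp]
    fun_prop
  have hvc : ∀ t, Continuous fun x : Sph d =>
      ⟪n - β t • w, attentionField B (m t : Measure (Sph d)) x⟫ := fun t =>
    continuous_inner_attentionField B (T := Sph d) (m := fun _ => m t) continuous_const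
      (x := fun x => (x : E d)) (n := fun _ => n - β t • w) (by fun_prop) (by fun_prop)
  have hp0 : ∀ t x, 0 ≤ p t x := fun t x => le_max_right _ _
  set F : ℝ → ℝ := fun t => ∫ x, p t x ^ 2 ∂(m t : Measure (Sph d)) with hF
  have hFc : Continuous F :=
    ProbabilityMeasure.continuous_integral_of_compactSpace hm.continuous
      (G := fun t x => p t x ^ 2) (hpc.pow 2)
  set D : ℝ → ℝ := fun t => (∫ x : Sph d, 2 * p t x *
      ⟪n - β t • w, attentionField B (m t : Measure (Sph d)) x⟫ ∂(m t : Measure (Sph d))) -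
    β' t * ∫ x : Sph d, 2 * p t x * ⟪w, (x : E d)⟫ ∂(m t : Measure (Sph d)) with hD
  -- Grönwall needs only an upper bound on right difference quotients. The motion of the test
  -- function is handled by `b₊² ≤ a₊² + 2 a₊ (b - a) + (b - a)²`, whose last term is of second
  -- order in `β z - β s`.
  have hdini : ∀ s, t₀ ≤ s → ∀ r, D s < r → ∃ᶠ z in 𝓝[>] s, (z - s)⁻¹ * (F z - F s) < r := by
    intro s hs r hr
    set Φ : ℝ → ℝ := fun z => ∫ x, p s x ^ 2 ∂(m z : Measure (Sph d)) with hΦ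
    set Ψ : ℝ → ℝ := fun z => ∫ x : Sph d, 2 * p s x * ⟪w, (x : E d)⟫ ∂(m z : Measure (Sph d))
      with hΨ
    have hΨc : Continuous Ψ := by
      refine ProbabilityMeasure.continuous_integral_of_compactSpace hm.continuous
        (G := fun _ (x : Sph d) => 2 * p s x * ⟪w, (x : E d)⟫) ?_
      unfold Function.uncurry
      have := hpt s
      fun_prop
    have hΦd := hasDerivWithinAt_iff_tendsto_slope.1
      (hm.hasDerivWithinAt γ (n - β s • w) s (ht₀.trans hs))
    have hset : Ici s \ {s} = Ioi s := by simp
    rw [hset] at hΦd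
    have hβd := hasDerivWithinAt_iff_tendsto_slope.1 ((hβ s).hasDerivWithinAt (s := Ici s))
    rw [hset] at hβd
    have hlim : Tendsto (fun z => slope Φ s z - slope β s z * Ψ z +
        slope β s z * (β z - β s) * ‖w‖ ^ 2) (𝓝[>] s) (𝓝 (D s)) := by
      have h1 : Tendsto Ψ (𝓝[>] s) (𝓝 (Ψ s)) := (hΨc.tendsto s).mono_left nhdsWithin_le_nhds
      have h2 : Tendsto (fun z => β z - β s) (𝓝[>] s) (𝓝 0) := by
        have := ((hβc.tendsto s).mono_left (nhdsWithin_le_nhds (s := Ioi s))).sub_const (β s)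
        simpa using this
      have := (hΦd.sub (hβd.mul h1)).add ((hβd.mul h2).mul_const (‖w‖ ^ 2))
      simpa using this
    refine Eventually.frequently ?_
    filter_upwards [hlim.eventually_lt_const hr, self_mem_nhdsWithin] with z hz hzs
    refine lt_of_le_of_lt ?_ hz
    have hzs' : 0 < z - s := sub_pos.2 hzs
    have hFz : F z ≤ Φ z - (β z - β s) * Ψ z + (β z - β s) ^ 2 * ‖w‖ ^ 2 := by
      have hpt' := hpt s
      have hi1 : Integrable (fun x : Sph d => p s x ^ 2) (m z : Measure (Sph d)) :=
        integrable_of_continuous (by fun_prop)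
      have hi2 : Integrable (fun x : Sph d => (β z - β s) * (2 * p s x * ⟪w, (x : E d)⟫))
        (m z : Measure (Sph d)) := integrable_of_continuous (by fun_prop)
      have hi3 : Integrable (fun _ : Sph d => (β z - β s) ^ 2 * ‖w‖ ^ 2)
        (m z : Measure (Sph d)) := integrable_const _
      have hi12 : Integrable (fun x : Sph d => p s x ^ 2 -
        (β z - β s) * (2 * p s x * ⟪w, (x : E d)⟫)) (m z : Measure (Sph d)) := hi1.sub hi2
      have hsum : Φ z - (β z - β s) * Ψ z + (β z - β s) ^ 2 * ‖w‖ ^ 2 =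
          ∫ x : Sph d, (p s x ^ 2 - (β z - β s) * (2 * p s x * ⟪w, (x : E d)⟫) +
            (β z - β s) ^ 2 * ‖w‖ ^ 2) ∂(m z : Measure (Sph d)) := by
        rw [integral_add hi12 hi3, integral_sub hi1 hi2, integral_const_mul]
        simp [hΦ, hΨ]
      rw [hsum]
      refine integral_mono (integrable_of_continuous ((hpt z).pow 2)) (hi12.add hi3)
        fun x => ?_
      have hw : ⟪w, (x : E d)⟫ ^ 2 ≤ ‖w‖ ^ 2 := by
        have h := abs_real_inner_le_norm w (x : E d)
        rw [norm_eq_of_mem_sphere, mul_one] at h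
        exact sq_le_sq' (abs_le.1 h).1 (abs_le.1 h).2
      have hmax : ∀ a b : ℝ, max b 0 ^ 2 ≤ max a 0 ^ 2 + 2 * max a 0 * (b - a) + (b - a) ^ 2 := by
        intro a b
        rcases le_total a 0 with ha | ha <;> rcases le_total b 0 with hb | hb <;>
          simp only [ha, hb, max_eq_left, max_eq_right] <;> nlinarith
      have hab := hmax (γ + ⟪n - β s • w, (x : E d)⟫) (γ + ⟪n - β z • w, (x : E d)⟫)
      have hdiff : γ + ⟪n - β z • w, (x : E d)⟫ - (γ + ⟪n - β s • w, (x : E d)⟫) =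
          -(β z - β s) * ⟪w, (x : E d)⟫ := by
        simp only [inner_sub_left, real_inner_smul_left]
        ring
      rw [hdiff] at hab
      simp only [hp]
      nlinarith [mul_le_mul_of_nonneg_left hw (sq_nonneg (β z - β s))]
    have hΦs : Φ s = F s := rfl
    calc (z - s)⁻¹ * (F z - F s)
        ≤ (z - s)⁻¹ * (Φ z - (β z - β s) * Ψ z + (β z - β s) ^ 2 * ‖w‖ ^ 2 - Φ s) := by
          rw [hΦs]
          gcongr
      _ = _ := by
          simp only [slope_def_field]
          field_simp
          ring
  -- The barrier hypothesis, integrated against `2 p`, gives `2 C (F + I²)`, and `I² ≤ F` absorbs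
  -- the nonlocal term.
  have hDF : ∀ s, t₀ ≤ s → D s ≤ 4 * C * F s := by
    intro s hs
    set I := ∫ y, p s y ∂(m s : Measure (Sph d)) with hI
    have hps := hpt s
    have hvs := hvc s
    have hcs := integral_sq_le_integral_sq (μ := (m s : Measure (Sph d))) hps
    have e1 : D s = ∫ x : Sph d, 2 * p s x *
        (⟪n - β s • w, attentionField B (m s : Measure (Sph d)) x⟫ - β' s * ⟪w, (x : E d)⟫)
        ∂(m s : Measure (Sph d)) := by
      simp only [hD]
      rw [← integral_const_mul, ← integral_sub (integrable_of_continuous (by fun_prop))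
        (integrable_of_continuous (by fun_prop))]
      exact integral_congr_ae (Eventually.of_forall fun x => by simp only; ring)
    have e2 : ∫ x : Sph d, (2 * C * p s x ^ 2 + 2 * C * I * p s x) ∂(m s : Measure (Sph d)) =
        2 * C * F s + 2 * C * I * I := by
      rw [integral_add (integrable_of_continuous (by fun_prop))
        (integrable_of_continuous (by fun_prop)), integral_const_mul, integral_const_mul]
    have e3 : D s ≤ 2 * C * F s + 2 * C * I * I := by
      rw [e1, ← e2]
      refine integral_mono (integrable_of_continuous (by fun_prop))
        (integrable_of_continuous (by fun_prop)) fun x => ?_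
      rcases le_or_gt (γ + ⟪n - β s • w, (x : E d)⟫) 0 with hneg | hpos
      · have : p s x = 0 := max_eq_right hneg
        simp [this]
      · have hpx : p s x = γ + ⟪n - β s • w, (x : E d)⟫ := max_eq_left hpos.le
        have := hbar s hs x hpos
        rw [← hpx] at this
        have h2 := mul_le_mul_of_nonneg_left this
          (show 0 ≤ 2 * p s x by linarith [hp0 s x])
        simp only
        calc _ ≤ _ := h2
          _ = _ := by simp only [hI, hp]; ring
    have : C * I ^ 2 ≤ C * F s := mul_le_mul_of_nonneg_left hcs hC
    nlinarith
  have hsupp : ∀ s, F s = 0 ↔ ∀ x ∈ (m s : Measure (Sph d)).support,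
      γ + ⟪n - β s • w, (x : E d)⟫ ≤ 0 := by
    intro s
    have hps := hpt s
    have hiff : ∀ x, p s x ^ 2 = 0 ↔ γ + ⟪n - β s • w, (x : E d)⟫ ≤ 0 := fun x => by
      simp [hp]
    rw [hF, integral_eq_zero_iff_of_nonneg (fun x => sq_nonneg _)
      (integrable_of_continuous (hps.pow 2))]
    constructor
    · intro h x hx
      refine Measure.support_subset_of_isClosed
        (t := {x : Sph d | γ + ⟪n - β s • w, (x : E d)⟫ ≤ 0})
        (isClosed_le (by fun_prop) continuous_const) ?_ hx
      filter_upwards [h] with x hx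
      exact (hiff x).1 hx
    · intro h
      filter_upwards [Measure.support_mem_ae (μ := (m s : Measure (Sph d)))] with x hx
      exact (hiff x).2 (h x hx)
  have hFt : F t ≤ 0 := by
    have := le_gronwallBound_of_liminf_deriv_right_le (f := F) (f' := D) (δ := 0) (K := 4 * C)
      (ε := 0) (a := t₀) (b := t) hFc.continuousOn (fun s hs => hdini s hs.1)
      ((hsupp t₀).2 h₀).le (fun s hs => by simpa using hDF s hs.1) t ⟨ht, le_rfl⟩
    simpa [gronwallBound_ε0_δ0] using this
  exact (hsupp t).1 (le_antisymm hFt (integral_nonneg fun x => sq_nonneg _)) x hx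

end Transformer

/-! ### Attention bounds, contraction and the limit point -/

namespace Transformer

variable {d : ℕ}

theorem add_inner_attention (B : Matrix (Fin d) (Fin d) ℝ) (μ : Measure (Sph d))
    [IsProbabilityMeasure μ] (x n : E d) (γ : ℝ) :
    γ + ⟪n, attention B μ x⟫ = (∫ y : Sph d, Real.exp ⟪mulE B x, (y : E d)⟫ ∂μ)⁻¹ *
      ∫ y : Sph d, Real.exp ⟪mulE B x, (y : E d)⟫ * (γ + ⟪n, (y : E d)⟫) ∂μ := by
  have hZ := (attention_weight_pos B μ x).ne'
  simp only [mul_add]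
  rw [inner_attention, integral_add (integrable_of_continuous (by fun_prop))
    (integrable_of_continuous (by fun_prop)), integral_mul_const]
  field_simp

theorem abs_inner_attention_le_one (B : Matrix (Fin d) (Fin d) ℝ) (μ : Measure (Sph d))
    [IsProbabilityMeasure μ] (x : E d) (n : Sph d) : |⟪(n : E d), attention B μ x⟫| ≤ 1 := by
  have hZ := attention_weight_pos B μ x
  have key : ∀ k : E d, ‖k‖ ≤ 1 → ⟪k, attention B μ x⟫ ≤ 1 := by
    intro k hk
    rw [inner_attention, inv_mul_le_iff₀ hZ, mul_one]
    refine integral_mono (integrable_of_continuous (by fun_prop))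
      (integrable_of_continuous (by fun_prop)) fun y => ?_
    have h := (real_inner_le_norm k (y : E d)).trans_eq
      (by rw [norm_eq_of_mem_sphere, mul_one])
    exact mul_le_of_le_one_right (Real.exp_pos _).le (h.trans hk)
  have hn : ‖(n : E d)‖ ≤ 1 := (norm_eq_of_mem_sphere n).le
  rw [abs_le]
  have := key (-(n : E d)) (by rwa [norm_neg])
  rw [inner_neg_left] at this
  exact ⟨by linarith, key _ hn⟩

/-- The attention weights are bounded above and below, uniformly in the measure. -/
theorem exists_attention_le (B : Matrix (Fin d) (Fin d) ℝ) :
    ∃ κ : ℝ, 0 < κ ∧ ∀ (μ : Measure (Sph d)) [IsProbabilityMeasure μ] (x : Sph d) (n : E d) (γ : ℝ),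
      γ + ⟪n, attention B μ x⟫ ≤ κ * ∫ y : Sph d, (γ + ⟪n, (y : E d)⟫) ∂μ +
        κ⁻¹ * ∫ y : Sph d, max (γ + ⟪n, (y : E d)⟫) 0 ∂μ := by
  obtain ⟨b, hb⟩ : ∃ b : ℝ, ∀ x y : Sph d, |⟪mulE B x, (y : E d)⟫| ≤ b := by
    obtain ⟨b, hb⟩ := (isCompact_univ (X := Sph d × Sph d)).exists_bound_of_continuousOn
      (f := fun p => ⟪mulE B p.1, (p.2 : E d)⟫) (by fun_prop)
    exact ⟨b, fun x y => hb (x, y) trivial⟩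
  -- The normalized weight lies in `[exp (-2 b), exp (2 b)]`. Negative values of the affine function
  -- keep at least the weight `κ`, and positive ones get at most `κ⁻¹`.
  refine ⟨Real.exp (-b) * Real.exp (-b), by positivity, fun μ _ x n γ => ?_⟩
  set e : Sph d → ℝ := fun y => Real.exp ⟪mulE B x, (y : E d)⟫ with he
  have hec : Continuous e := by
    simp only [he]
    fun_prop
  set Z := ∫ y, e y ∂μ with hZ
  have hZ0 : 0 < Z := attention_weight_pos B μ x
  have hel : ∀ y, Real.exp (-b) ≤ e y := fun y => Real.exp_le_exp.2 (abs_le.1 (hb x y)).1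
  have heu : ∀ y, e y ≤ Real.exp b := fun y => Real.exp_le_exp.2 (abs_le.1 (hb x y)).2
  have hZl : Real.exp (-b) ≤ Z := by
    simpa using integral_mono (μ := μ) (integrable_const _) (integrable_of_continuous hec) hel
  have hZu : Z ≤ Real.exp b := by
    simpa using integral_mono (μ := μ) (integrable_of_continuous hec) (integrable_const _) heu
  have hinv : (Real.exp (-b))⁻¹ = Real.exp b := by rw [Real.exp_neg, inv_inv]
  have hZi1 : Real.exp (-b) ≤ Z⁻¹ := by
    rw [Real.exp_neg]
    exact inv_anti₀ hZ0 hZu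
  have hZi2 : Z⁻¹ ≤ Real.exp b := by
    rw [← hinv]
    exact inv_anti₀ (Real.exp_pos _) hZl
  rw [add_inner_attention, mul_inv, hinv, ← integral_const_mul, ← integral_const_mul,
    ← integral_const_mul, ← integral_add (integrable_of_continuous (by fun_prop))
    (integrable_of_continuous (by fun_prop))]
  refine integral_mono (integrable_of_continuous (by fun_prop))
    (integrable_of_continuous (by fun_prop)) fun y => ?_
  have h1 : Real.exp (-b) * Real.exp (-b) ≤ Z⁻¹ * e y :=
    mul_le_mul hZi1 (hel y) (Real.exp_pos _).le (inv_nonneg.2 hZ0.le)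
  have h2 : Z⁻¹ * e y ≤ Real.exp b * Real.exp b :=
    mul_le_mul hZi2 (heu y) (Real.exp_pos _).le (Real.exp_pos _).le
  have h3 : 0 < Real.exp b * Real.exp b := by positivity
  show Z⁻¹ * (e y * (γ + ⟪n, (y : E d)⟫)) ≤ _
  rw [← mul_assoc]
  rcases le_total (γ + ⟪n, (y : E d)⟫) 0 with h | h
  · simp only [max_eq_right h]
    nlinarith
  · simp only [max_eq_left h]
    have h4 : 0 < Real.exp (-b) * Real.exp (-b) := by positivity
    nlinarith

/-- This isolates the excess `γ + ⟪n, x⟫` over the cap. As `⟪x, attention⟫ ≤ 1`, the middle term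
helps exactly when `γ ≥ 0`, that is, for caps no larger than a hemisphere. -/
theorem add_inner_attentionField (B : Matrix (Fin d) (Fin d) ℝ) (μ : Measure (Sph d)) (x n : E d)
    (γ : ℝ) : ⟪n, attentionField B μ x⟫ = (γ + ⟪n, attention B μ x⟫) -
      γ * (1 - ⟪x, attention B μ x⟫) - ⟪x, attention B μ x⟫ * (γ + ⟪n, x⟫) := by
  rw [attentionField, inner_projPerp]
  ring

/-- Caps that are smaller than a hemisphere are invariant. -/
theorem AttentionFlow.le_zero_of_le_zero {B : Matrix (Fin d) (Fin d) ℝ}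
    {m : ℝ → ProbabilityMeasure (Sph d)} (hm : AttentionFlow B m) {γ : ℝ} (hγ : 0 ≤ γ) {n : E d}
    {t₀ : ℝ} (ht₀ : 0 ≤ t₀)
    (h₀ : ∀ x ∈ (m t₀ : Measure (Sph d)).support, γ + ⟪n, (x : E d)⟫ ≤ 0)
    {t : ℝ} (ht : t₀ ≤ t) {x : Sph d} (hx : x ∈ (m t : Measure (Sph d)).support) :
    γ + ⟪n, (x : E d)⟫ ≤ 0 := by
  obtain ⟨κ, hκ, hatt⟩ := exists_attention_le B
  have := hm.le_zero_of_barrier (β := fun _ => 0) (β' := fun _ => 0)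
    (fun t => hasDerivAt_const t 0) (γ := γ) (n := n) (w := 0) (t₀ := t₀) (C := κ + κ⁻¹ + 1) ht₀
    (by positivity) ?_ (by simpa using h₀) ht hx
  · simpa using this
  intro s _ y hy
  simp only [smul_zero, sub_zero, zero_mul] at hy ⊢
  set I := ∫ y : Sph d, max (γ + ⟪n, (y : E d)⟫) 0 ∂(m s : Measure (Sph d))
  have hI : ∫ y : Sph d, (γ + ⟪n, (y : E d)⟫) ∂(m s : Measure (Sph d)) ≤ I :=
    integral_mono (integrable_of_continuous (by fun_prop))
      (integrable_of_continuous (by fun_prop)) fun y => le_max_left _ _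
  have hI0 : 0 ≤ I := integral_nonneg fun y => le_max_right _ _
  have h1 := hatt (m s : Measure (Sph d)) y n γ
  have h2 := abs_le.1 (abs_inner_attention_le_one B (m s : Measure (Sph d)) y y)
  rw [add_inner_attentionField B _ _ _ γ]
  have h3 : 0 ≤ γ * (1 - ⟪(y : E d), attention B (m s : Measure (Sph d)) y⟫) :=
    mul_nonneg hγ (by linarith [h2.2])
  have h4 : -(γ + ⟪n, (y : E d)⟫) ≤
      ⟪(y : E d), attention B (m s : Measure (Sph d)) y⟫ * (γ + ⟪n, (y : E d)⟫) := by
    nlinarith [h2.1]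
  have h5 := mul_le_mul_of_nonneg_left hI hκ.le
  have h6 : 0 ≤ (κ + κ⁻¹) * (γ + ⟪n, (y : E d)⟫) := by positivity
  nlinarith

/-- Variation of constants for `β' = -c (β - N)`, `β 0 = β₀`. -/
theorem hasDerivAt_relaxation {N : ℝ → ℝ} (hN : Continuous N) (c β₀ t : ℝ) :
    HasDerivAt (fun t => Real.exp (-c * t) * (β₀ + ∫ s in (0 : ℝ)..t, c * Real.exp (c * s) * N s))
      (-c * (Real.exp (-c * t) * (β₀ + ∫ s in (0 : ℝ)..t, c * Real.exp (c * s) * N s) - N t)) t := by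
  have hg : Continuous fun s => c * Real.exp (c * s) * N s := by fun_prop
  have h1 : HasDerivAt (fun t => β₀ + ∫ s in (0 : ℝ)..t, c * Real.exp (c * s) * N s)
      (c * Real.exp (c * t) * N t) t :=
    (intervalIntegral.integral_hasDerivAt_right (hg.intervalIntegrable _ _)
      hg.stronglyMeasurable.stronglyMeasurableAtFilter hg.continuousAt).const_add _
  have h2 : HasDerivAt (fun t => Real.exp (-c * t)) (Real.exp (-c * t) * (-c)) t := by
    simpa using ((hasDerivAt_id t).const_mul (-c)).exp
  have he : Real.exp (-c * t) * Real.exp (c * t) = 1 := by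
    rw [← Real.exp_add]
    simp
  refine (h2.mul h1).congr_deriv ?_
  linear_combination c * N t * he

/-- In the gnomonic chart centred at `w`, the width of the support in every direction contracts
exponentially. -/
theorem AttentionFlow.exists_contraction {B : Matrix (Fin d) (Fin d) ℝ}
    {m : ℝ → ProbabilityMeasure (Sph d)} (hm : AttentionFlow B m) {w : Sph d} {c₀ : ℝ}
    (hc₀ : 0 < c₀) (hw : ∀ x ∈ (m 0 : Measure (Sph d)).support, c₀ ≤ ⟪(w : E d), (x : E d)⟫) :
    ∃ c : ℝ, 0 < c ∧ ∀ n : E d, ‖n‖ ≤ 1 → ∃ β₁ β₂ : ℝ → ℝ,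
      (∀ t, β₁ t + β₂ t = 2 / c₀ * Real.exp (-c * t)) ∧
      ∀ t, 0 ≤ t → ∀ x ∈ (m t : Measure (Sph d)).support,
        ⟪n - β₁ t • (w : E d), (x : E d)⟫ ≤ 0 ∧ ⟪-n - β₂ t • (w : E d), (x : E d)⟫ ≤ 0 := by
  obtain ⟨κ, hκ, hatt⟩ := exists_attention_le B
  have hwt : ∀ t, 0 ≤ t → ∀ x ∈ (m t : Measure (Sph d)).support, c₀ ≤ ⟪(w : E d), (x : E d)⟫ := by
    intro t ht x hx
    have := hm.le_zero_of_le_zero hc₀.le (n := -(w : E d)) le_rfl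
      (fun x hx => by rw [inner_neg_left]; linarith [hw x hx]) ht hx
    rw [inner_neg_left] at this
    linarith
  set W : ℝ → ℝ := fun t => ∫ y : Sph d, ⟪(w : E d), (y : E d)⟫ ∂(m t : Measure (Sph d)) with hW
  have hw1 : ∀ y : Sph d, |⟪(w : E d), (y : E d)⟫| ≤ 1 := fun y => by
    simpa using abs_real_inner_le_norm (w : E d) (y : E d)
  have hWc : ∀ t, 0 ≤ t → c₀ ≤ W t := by
    intro t ht
    have := integral_mono_ae (μ := (m t : Measure (Sph d))) (integrable_const c₀)
      (integrable_of_continuous (f := fun y : Sph d => ⟪(w : E d), (y : E d)⟫) (by fun_prop))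
      (by filter_upwards [Measure.support_mem_ae (μ := (m t : Measure (Sph d)))] with x hx
          exact hwt t ht x hx)
    simpa using this
  have hW1 : ∀ t, W t ≤ 1 := by
    intro t
    have := integral_mono (μ := (m t : Measure (Sph d)))
      (integrable_of_continuous (f := fun y : Sph d => ⟪(w : E d), (y : E d)⟫) (by fun_prop))
      (integrable_const 1) fun x => (abs_le.1 (hw1 x)).2
    simpa using this
  have hcont : ∀ n : E d, Continuous fun t => ∫ y : Sph d, ⟪n, (y : E d)⟫
      ∂(m t : Measure (Sph d)) := fun n => by
    refine ProbabilityMeasure.continuous_integral_of_compactSpace hm.continuous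
      (G := fun _ (y : Sph d) => ⟪n, (y : E d)⟫) ?_
    unfold Function.uncurry
    fun_prop
  -- The chart coordinate of the barycenter. The `max` is inactive for `t ≥ 0` and keeps the
  -- quotient continuous at negative times.
  set N : E d → ℝ → ℝ := fun n t =>
    (∫ y : Sph d, ⟪n, (y : E d)⟫ ∂(m t : Measure (Sph d))) / max (W t) c₀ with hN
  have hNc : ∀ n, Continuous (N n) := fun n =>
    (hcont n).div ((hcont w).max continuous_const) fun t => (lt_max_of_lt_right hc₀).ne'
  -- Since `W ≥ c₀` and `⟪w, y⟫ ≤ 1`, this rate makes the factor `κ W - c ⟪w, y⟫` nonnegative.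
  set c : ℝ := κ * c₀ with hc
  have hcpos : 0 < c := by positivity
  set β : E d → ℝ → ℝ := fun n t => Real.exp (-c * t) *
    (1 / c₀ + ∫ s in (0 : ℝ)..t, c * Real.exp (c * s) * N n s) with hβ
  have hone : ∀ n : E d, ‖n‖ ≤ 1 → ∀ t, 0 ≤ t → ∀ x ∈ (m t : Measure (Sph d)).support,
      ⟪n - β n t • (w : E d), (x : E d)⟫ ≤ 0 := by
    intro n hn t ht x hx
    have := hm.le_zero_of_barrier (β := β n) (β' := fun t => -c * (β n t - N n t))
      (fun t => hasDerivAt_relaxation (hNc n) c _ t) (γ := 0) (n := n) (w := w) (t₀ := 0)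
      (C := κ⁻¹ + 1 + (κ + c) / c₀) le_rfl (by positivity) ?_ ?_ ht hx
    · simpa using this
    · intro s hs y hy
      simp only [zero_add] at hy ⊢
      set q := ⟪n - β n s • (w : E d), (y : E d)⟫ with hq
      set I := ∫ y : Sph d, max ⟪n - β n s • (w : E d), (y : E d)⟫ 0 ∂(m s : Measure (Sph d))
      have hI0 : 0 ≤ I := integral_nonneg fun y => le_max_right _ _
      have hWs := hWc s hs
      have hJ : ∫ y : Sph d, ⟪n - β n s • (w : E d), (y : E d)⟫ ∂(m s : Measure (Sph d)) =
          W s * (N n s - β n s) := by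
        have hNs : W s * N n s = ∫ y : Sph d, ⟪n, (y : E d)⟫ ∂(m s : Measure (Sph d)) := by
          simp only [hN, max_eq_left hWs]
          field_simp [(hc₀.trans_le hWs).ne']
        simp only [inner_sub_left, real_inner_smul_left]
        rw [integral_sub (integrable_of_continuous (by fun_prop))
          (integrable_of_continuous (by fun_prop)), integral_const_mul, mul_sub, hNs, mul_comm]
      have hJI : W s * (N n s - β n s) ≤ I := by
        rw [← hJ]
        exact integral_mono (integrable_of_continuous (by fun_prop))
          (integrable_of_continuous (by fun_prop)) fun y => le_max_left _ _
      have h1 := hatt (m s : Measure (Sph d)) y (n - β n s • (w : E d)) 0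
      simp only [zero_add] at h1
      rw [hJ] at h1
      have h2 := abs_le.1 (abs_inner_attention_le_one B (m s : Measure (Sph d)) y y)
      have h3 : -q ≤ ⟪(y : E d), attention B (m s : Measure (Sph d)) y⟫ * q := by
        nlinarith [h2.1]
      have hy1 := abs_le.1 (hw1 y)
      -- Attraction to the mean minus the motion of the barrier. It has the good sign if `N ≤ β`;
      -- otherwise the barycenter is itself beyond the barrier, and `N - β ≤ I / c₀`.
      have h4 : (N n s - β n s) * (κ * W s - c * ⟪(w : E d), (y : E d)⟫) ≤ (κ + c) / c₀ * I := by
        have hfac0 : 0 ≤ κ * W s - c * ⟪(w : E d), (y : E d)⟫ := by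
          have : κ * c₀ ≤ κ * W s := mul_le_mul_of_nonneg_left hWs hκ.le
          nlinarith
        have hfac1 : κ * W s - c * ⟪(w : E d), (y : E d)⟫ ≤ κ + c := by
          have : κ * W s ≤ κ * 1 := mul_le_mul_of_nonneg_left (hW1 s) hκ.le
          nlinarith
        rcases le_total (N n s) (β n s) with hle | hle
        · have h5 : (N n s - β n s) * (κ * W s - c * ⟪(w : E d), (y : E d)⟫) ≤ 0 :=
            mul_nonpos_of_nonpos_of_nonneg (by linarith) hfac0
          have h6 : 0 ≤ (κ + c) / c₀ * I := by positivity
          linarith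
        · have h5 : N n s - β n s ≤ I / c₀ := by
            rw [le_div_iff₀ hc₀]
            nlinarith
          calc _ ≤ I / c₀ * (κ + c) := mul_le_mul h5 hfac1 hfac0 (by positivity)
            _ = _ := by ring
      have h7 := add_inner_attentionField B (m s : Measure (Sph d)) y (n - β n s • (w : E d)) 0
      simp only [zero_add, zero_mul, sub_zero] at h7
      rw [h7]
      have h8 : 0 ≤ (κ⁻¹ + (κ + c) / c₀) * q := by positivity
      have h9 : 0 ≤ κ⁻¹ * I := by positivity
      rw [← hq]
      nlinarith
    · intro y hy
      have hβ0 : β n 0 = 1 / c₀ := by simp [hβ]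
      have h1 : ⟪n, (y : E d)⟫ ≤ 1 := by
        have := real_inner_le_norm n (y : E d)
        rw [norm_eq_of_mem_sphere, mul_one] at this
        exact this.trans hn
      have h2 := hw y hy
      have h3 : 1 ≤ 1 / c₀ * ⟪(w : E d), (y : E d)⟫ := by
        rw [one_div, inv_mul_eq_div, le_div_iff₀ hc₀]
        linarith
      rw [hβ0, inner_sub_left, real_inner_smul_left]
      linarith
  refine ⟨c, hcpos, fun n hn => ⟨β n, β (-n), fun t => ?_, fun t ht x hx =>
    ⟨hone n hn t ht x hx, hone (-n) (by rwa [norm_neg]) t ht x hx⟩⟩⟩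
  -- The forcing terms for `n` and `-n` cancel in the sum, leaving the pure exponential.
  have hneg : ∀ s, N (-n) s = -N n s := fun s => by
    simp only [hN, inner_neg_left]
    rw [integral_neg, neg_div]
  simp only [hβ, hneg, mul_neg]
  rw [intervalIntegral.integral_neg]
  ring

/-- For `u = b x - a z`, the widths bound `‖u‖ / (a b)`, the distance between the chart images.
Comparing norms gives `|b - a| ≤ ‖u‖`, so `b (x - z) = u + (a - b) z` has norm at most `2 ‖u‖`. -/
theorem norm_sub_le_of_widths {w x z : Sph d} {η : ℝ} (hx : 0 < ⟪(w : E d), (x : E d)⟫)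
    (hz : 0 < ⟪(w : E d), (z : E d)⟫)
    (h : ∀ n : E d, ‖n‖ ≤ 1 → ∃ β₁ β₂ : ℝ, β₁ + β₂ = η ∧
      (⟪n - β₁ • (w : E d), (x : E d)⟫ ≤ 0 ∧ ⟪-n - β₂ • (w : E d), (x : E d)⟫ ≤ 0) ∧
      (⟪n - β₁ • (w : E d), (z : E d)⟫ ≤ 0 ∧ ⟪-n - β₂ • (w : E d), (z : E d)⟫ ≤ 0)) :
    ‖(x : E d) - z‖ ≤ 2 * η := by
  set a := ⟪(w : E d), (x : E d)⟫ with ha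
  set b := ⟪(w : E d), (z : E d)⟫ with hb
  have ha1 : a ≤ 1 := by simpa using real_inner_le_norm (w : E d) (x : E d)
  set u : E d := b • (x : E d) - a • (z : E d) with hu
  have hunorm : ‖u‖ ≤ η * a * b := by
    have key : ∀ n : E d, ‖n‖ ≤ 1 → ⟪n, u⟫ ≤ η * a * b := by
      intro n hn
      obtain ⟨β₁, β₂, rfl, ⟨h1, h2⟩, h3, h4⟩ := h n hn
      simp only [inner_sub_left, real_inner_smul_left, inner_neg_left, ← ha, ← hb] at h1 h2 h3 h4
      rw [hu, inner_sub_right, real_inner_smul_right, real_inner_smul_right]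
      nlinarith
    rcases eq_or_ne u 0 with h0 | h0
    · simpa [h0] using key 0 (by simp)
    · have hpos := norm_pos_iff.2 h0
      have := key (‖u‖⁻¹ • u) (by rw [norm_smul, norm_inv, norm_norm, inv_mul_cancel₀ hpos.ne'])
      rwa [real_inner_smul_left, real_inner_self_eq_norm_sq, sq, inv_mul_cancel_left₀ hpos.ne']
        at this
  have hab : |b - a| ≤ ‖u‖ := by
    have := abs_norm_sub_norm_le (b • (x : E d)) (a • (z : E d))
    rwa [norm_smul, norm_smul, norm_eq_of_mem_sphere, norm_eq_of_mem_sphere,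
      Real.norm_of_nonneg hx.le, Real.norm_of_nonneg hz.le, mul_one, mul_one] at this
  have hmain : b * ‖(x : E d) - z‖ ≤ b * (2 * η * a) := by
    have h1 : b • ((x : E d) - z) = u + (a - b) • (z : E d) := by
      rw [hu]
      module
    have h2 := norm_add_le u ((a - b) • (z : E d))
    rw [← h1, norm_smul, norm_smul, norm_eq_of_mem_sphere, mul_one, Real.norm_of_nonneg hz.le,
      Real.norm_eq_abs, abs_sub_comm] at h2
    nlinarith
  have h3 := le_of_mul_le_mul_left hmain hz
  have h4 := norm_nonneg ((x : E d) - z)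
  have hη : 0 ≤ η := by
    by_contra! hneg
    nlinarith
  nlinarith

/-- The support of an attention flow that starts in an open hemisphere converges exponentially fast
to a point of the geodesic hull of the initial support. -/
theorem AttentionFlow.exists_limit {B : Matrix (Fin d) (Fin d) ℝ}
    {m : ℝ → ProbabilityMeasure (Sph d)} (hm : AttentionFlow B m)
    (h₀ : InOpenHemisphere (m 0 : Measure (Sph d)).support) :
    ∃ z ∈ geodHull (m 0 : Measure (Sph d)).support, ∃ c R : ℝ, 0 < c ∧ 1 ≤ R ∧
      ∀ t, 0 ≤ t → ∀ x ∈ (m t : Measure (Sph d)).support,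
        geodDist x z ≤ R * Real.exp (-c * t) := by
  obtain ⟨w, hw⟩ := h₀
  have hne : ∀ t, (m t : Measure (Sph d)).support.Nonempty := fun t =>
    Measure.nonempty_support (IsProbabilityMeasure.ne_zero _)
  obtain ⟨c₀, hc₀, hwc⟩ : ∃ c₀ : ℝ, 0 < c₀ ∧ ∀ x ∈ (m 0 : Measure (Sph d)).support,
      c₀ ≤ ⟪(w : E d), (x : E d)⟫ := by
    obtain ⟨x₀, hx₀, hmin⟩ := Measure.isClosed_support.isCompact.exists_isMinOn (hne 0)
      (f := fun x : Sph d => ⟪(w : E d), (x : E d)⟫) (by fun_prop)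
    exact ⟨_, hw x₀ hx₀, fun x hx => hmin hx⟩
  -- Unit vectors of the bipolar cone of the support; invariance of closed hemispheres makes these
  -- compact sets decrease in time.
  set K : ℝ → Set (Sph d) := fun t => {z | ∀ n : E d,
    (∀ x ∈ (m t : Measure (Sph d)).support, ⟪n, (x : E d)⟫ ≤ 0) → ⟪n, (z : E d)⟫ ≤ 0} with hK
  have hKanti : ∀ s t, 0 ≤ s → s ≤ t → K t ⊆ K s := by
    intro s t hs hst z hz n hn
    refine hz n fun x hx => ?_
    simpa using hm.le_zero_of_le_zero (γ := 0) le_rfl hs (by simpa using hn) hst hx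
  have hKc : ∀ t, IsClosed (K t) := by
    intro t
    simp only [hK, Set.ofPred_forall]
    exact isClosed_iInter fun n => isClosed_iInter fun _ =>
      isClosed_le (by fun_prop) continuous_const
  obtain ⟨z, hz⟩ := IsCompact.nonempty_iInter_of_sequence_nonempty_isCompact_isClosed
    (fun k : ℕ => K k) (fun k => hKanti _ _ (Nat.cast_nonneg k) (by simp))
    (fun k => (hne k).mono fun x hx n hn => hn x hx) (hKc _).isCompact fun k => hKc k
  have hzK : ∀ t, 0 ≤ t → z ∈ K t := fun t ht =>
    hKanti t _ ht (Nat.le_ceil t) (Set.mem_iInter.1 hz ⌈t⌉₊)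
  obtain ⟨c, hc, hcontr⟩ := hm.exists_contraction hc₀ hwc
  -- The polar condition alone gives only `≥ 0`. The barrier in the direction `z` itself gives `1 ≤
  -- β₁ 0 * ⟪w, z⟫`, which excludes zero.
  have hwz : 0 < ⟪(w : E d), (z : E d)⟫ := by
    obtain ⟨β₁, β₂, hsum, hβ⟩ := hcontr z (norm_eq_of_mem_sphere z).le
    have h1 := hzK 0 le_rfl _ fun x hx => (hβ 0 le_rfl x hx).1
    have h2 := hzK 0 le_rfl (-(w : E d)) fun x hx => by
      rw [inner_neg_left]
      linarith [hw x hx]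
    rw [inner_neg_left] at h2
    rw [inner_sub_left, real_inner_smul_left, real_inner_self_eq_norm_sq,
      norm_eq_of_mem_sphere] at h1
    rcases (show 0 ≤ ⟪(w : E d), (z : E d)⟫ by linarith).eq_or_lt with h | h
    · rw [← h] at h1
      norm_num at h1
    · exact h
  have hwt : ∀ t, 0 ≤ t → ∀ x ∈ (m t : Measure (Sph d)).support, 0 < ⟪(w : E d), (x : E d)⟫ := by
    intro t ht x hx
    have := hm.le_zero_of_le_zero hc₀.le (n := -(w : E d)) le_rfl
      (fun x hx => by rw [inner_neg_left]; linarith [hwc x hx]) ht hx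
    rw [inner_neg_left] at this
    linarith
  refine ⟨z, mem_geodHull_of_polar Measure.isClosed_support hw hwz (hzK 0 le_rfl), c,
    max 1 (Real.pi * (2 / c₀)), hc, le_max_left _ _, fun t ht x hx => ?_⟩
  have hchord := norm_sub_le_of_widths (η := 2 / c₀ * Real.exp (-c * t)) (hwt t ht x hx) hwz
    fun n hn => by
      obtain ⟨β₁, β₂, hsum, hβ⟩ := hcontr n hn
      exact ⟨β₁ t, β₂ t, hsum t, hβ t ht x hx, hzK t ht _ fun y hy => (hβ t ht y hy).1,
        hzK t ht _ fun y hy => (hβ t ht y hy).2⟩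
  calc geodDist x z ≤ Real.pi / 2 * ‖(x : E d) - z‖ := geodDist_le_chord x z
    _ ≤ Real.pi / 2 * (2 * (2 / c₀ * Real.exp (-c * t))) := by
        gcongr
    _ = Real.pi * (2 / c₀) * Real.exp (-c * t) := by ring
    _ ≤ _ := by
        gcongr
        exact le_max_right _ _

end Transformer

/-! ### Logarithmic hitting times and conclusion -/

/-- Hitting times of an exponentially decaying quantity are logarithmic. -/
theorem isBigO_sInf_log {S : ℝ → Set ℝ} {c R : ℝ} (hc : 0 < c) (hR : 1 ≤ R)
    (hS0 : ∀ ε, ∀ t ∈ S ε, 0 ≤ t) (hS : ∀ ε t, 0 ≤ t → R * Real.exp (-c * t) ≤ ε → t ∈ S ε) :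
    (fun ε => sInf (S ε)) =O[𝓝[>] 0] fun ε => Real.log (1 / ε) := by
  have hR0 : 0 < R := by linarith
  refine Asymptotics.IsBigO.of_bound (2 / c) ?_
  filter_upwards [Ioo_mem_nhdsGT (show (0 : ℝ) < 1 / R by positivity)] with ε hε
  have hε0 : 0 < ε := hε.1
  have hlogR : 0 ≤ Real.log R := Real.log_nonneg hR
  have hle : Real.log R ≤ Real.log (1 / ε) := by
    refine Real.log_le_log hR0 ?_
    rw [le_one_div hR0 hε0]
    exact hε.2.le
  -- This time solves `R exp (-c t) = ε`; as `ε < 1 / R`, the `log R` term is at most `log (1 / ε)`,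
  -- whence the constant `2 / c`.
  have hmem : (Real.log R + Real.log (1 / ε)) / c ∈ S ε := by
    refine hS ε _ (div_nonneg (by linarith) hc.le) (le_of_eq ?_)
    rw [show -c * ((Real.log R + Real.log (1 / ε)) / c) = -Real.log R + Real.log ε by
      rw [one_div, Real.log_inv]
      field_simp
      ring, Real.exp_add, Real.exp_neg, Real.exp_log hR0, Real.exp_log hε0]
    field_simp
  rw [Real.norm_of_nonneg (Real.sInf_nonneg (hS0 ε)), Real.norm_of_nonneg (hlogR.trans hle)]
  refine (csInf_le ⟨0, fun t ht => hS0 ε t ht⟩ hmem).trans ?_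
  rw [div_mul_eq_mul_div]
  gcongr
  linarith

theorem proposition2p1 {d : ℕ} (B : Matrix (Fin d) (Fin d) ℝ)
    (μ₀ : ProbabilityMeasure (Transformer.Sph d))
    (hμ₀ : Transformer.InOpenHemisphere (μ₀ : Measure (Transformer.Sph d)).support)
    (θ : ℝ → Transformer.Params d)
    (hV : ∀ t, 0 ≤ t → (θ t).V = 1) (hB : ∀ t, 0 ≤ t → (θ t).B = B)
    (hW : ∀ t, 0 ≤ t → (θ t).W = 0)
    (μ : ℝ → ProbabilityMeasure (Transformer.Sph d))
    (hμ : Transformer.IsWeakSolution θ μ₀ μ) :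
    Tendsto (fun t : ℝ => Transformer.geodDiam
      (Transformer.geodHull (μ t : Measure (Transformer.Sph d)).support)) atTop (𝓝 0) ∧
    ∃ z ∈ Transformer.geodHull (μ₀ : Measure (Transformer.Sph d)).support,
      (∀ ε : ℝ, 0 < ε →
        (∃ T : ℝ, 0 < T ∧
          Transformer.wasserstein ∞ (μ T) (Measure.dirac z) ≤ ENNReal.ofReal ε) ∧
        (Transformer.hittingTimes μ (Measure.dirac z) ε).Nonempty) ∧
      (fun ε : ℝ => sInf (Transformer.hittingTimes μ (Measure.dirac z) ε))
        =O[𝓝[>] 0] (fun ε : ℝ => Real.log (1 / ε)) := by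
  obtain ⟨z, hz, c, R, hc, hR, hdist⟩ := (hμ.attentionFlow hV hB hW).exists_limit
    (by simpa [hμ.initial] using hμ₀)
  have hdist' : ∀ t, 0 ≤ t → ∀ x ∈ (μ t : Measure (Transformer.Sph d)).support,
      Transformer.geodDist x z ≤ R * Real.exp (-c * t) := fun t ht x hx =>
    hdist t ht x (by simpa [max_eq_left ht] using hx)
  have hlim : Tendsto (fun t : ℝ => R * Real.exp (-c * t)) atTop (𝓝 0) := by
    have h : Tendsto (fun t : ℝ => -c * t) atTop atBot :=
      tendsto_id.const_mul_atTop_of_neg (neg_neg_of_pos hc)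
    simpa using (Real.tendsto_exp_atBot.comp h).const_mul R
  have hwass : ∀ (p : ℝ≥0∞) (ε t : ℝ), 0 ≤ t → R * Real.exp (-c * t) ≤ ε →
      Transformer.wasserstein p (μ t) (Measure.dirac z) ≤ ENNReal.ofReal ε := fun p ε t ht hε =>
    Transformer.wasserstein_dirac_le p _ z fun x hx => (hdist' t ht x hx).trans hε
  refine ⟨?_, z, by simpa [hμ.initial] using hz, fun ε hε => ?_, ?_⟩
  · refine squeeze_zero' (Eventually.of_forall fun t => Transformer.geodDiam_nonneg _) ?_
      (by have := hlim.const_mul 2; rwa [mul_zero] at this)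
    filter_upwards [eventually_ge_atTop 0, hlim.eventually_lt_const (half_pos Real.pi_pos)]
      with t ht hsmall
    exact Transformer.geodDiam_geodHull_le (by positivity) hsmall (hdist' t ht)
  · obtain ⟨T, hT, hTε⟩ :=
      ((eventually_gt_atTop 0).and (hlim.eventually_lt_const hε)).exists
    exact ⟨⟨T, hT, hwass ∞ ε T hT.le hTε.le⟩, T, hT.le, hwass 2 ε T hT.le hTε.le⟩
  · exact isBigO_sInf_log hc hR (fun ε t ht => ht.1) fun ε t ht hε => ⟨ht, hwass 2 ε t ht hε⟩
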